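/- Work over the modal language $\mathcal{L}=\{\wedge,\vee,\to,\top,\bot,\Box,\Diamond\}$ with countably many atoms. A \emph{logic} is a set of formulas closed under substitution, modus ponens and necessitation; $\mathsf{CK}$ is the least logic containing intuitionistic propositional logic, $\Box(p\to q)\to(\Box p\to\Box q)$ and $\Box(p\to q)\to(\Diamond p\to\Diamond q)$. A logic $L\supseteq\mathsf{CK}$ is \emph{$T$-free} if all its formulas are valid in the one-node irreflexive Kripke frame, and \emph{$T$-full} if it contains $\Box p\to p$ and $p\to\Diamond p$ and all its formulas are valid in the one-node reflexive Kripke frame (the node not being fallible). \emph{Basic} formulas are built from atoms, $\top$, $\bot$ by $\wedge,\vee,\Diamond$. \emph{Almost positive} formulas form the least set containing the basic formulas and closed under $\wedge,\vee,\Box,\Diamond$ and under $A\to B$ with $A$ basic and $B$ almost positive. \emph{Constructive} formulas form the least set containing the basic formulas and closed under $\wedge,\Box$ and under $A\to B$ with $A$ almost positive and $B$ constructive. All sequents are single-conclusion: $\Sigma\Rightarrow\Lambda$ with $\Sigma,\Lambda$ finite multisets of formulas and $\Lambda$ having at most one element. A \emph{left constructive} rule has the form $$\frac{\{\Gamma,\overline{B_i}\Rightarrow\overline{P_i}\}_{i\in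 I}\qquad\{\Gamma,\overline{C_j}\Rightarrow\Delta\}_{j\in J}}{\Gamma,\overline{P}\Rightarrow\Delta}$$ and a \emph{right constructive} rule has the form $$\frac{\{\Gamma,\overline{B_i}\Rightarrow\overline{P_i}\}_{i\in I}}{\Gamma,\overline{P}\Rightarrow\overline{C}}$$ where $I,J$ are finite and possibly empty, $\Gamma,\Delta$ are multiset variables, the $\overline{B_i}$ are multisets of basic formulas, $\overline{P},\overline{P_i}$ of almost positive formulas, $\overline{C},\overline{C_j}$ of constructive formulas, $\overline{P_i},\overline{C},\Delta$ have at most one element, and if $|J|>1$ all formulas in the $\overline{C_j}$ are basic. An instance of a rule is obtained by substituting formulas for the atoms and multisets of formulas for the multiset variables. A \emph{constructive sequent calculus} is a finite set of rules, each of which is left or right constructive, or is the rule $(K_\Box)$: from $\Gamma\Rightarrow p$ infer $\Box\Gamma\Rightarrow\Box p$, or the rule $(K_\Diamond)$: from $\Gamma,p\Rightarrow q$ infer $\Box\Gamma,\Diamond p\Rightarrow\Diamond q$. It is a calculus \emph{for} $L$ if, for every sequent $\Sigma\Rightarrow\Lambda$, it proves $\Sigma\Rightarrow\Lambda$ if and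 only if $\bigwedge\Sigma\to\bigvee\Lambda\in L$ (where $\bigwedge\varnothing=\top$ and $\bigvee\varnothing=\bot$). For $n\ge1$, \emph{Visser's rule} $V_n$ is $$\frac{\Rightarrow\left(\bigwedge_{i=1}^n(p_i\to q_i)\to p_{n+1}\vee p_{n+2}\right)\vee r}{\Rightarrow\bigvee_{j=1}^{n+2}\left(\bigwedge_{i=1}^n(p_i\to q_i)\to p_j\right)\vee r}$$ and it is admissible in $L$ if for each of its instances, $\bigwedge\Sigma\to\bigvee\Lambda\in L$ for the premise $\Sigma\Rightarrow\Lambda$ implies the same for the conclusion. $V_0$ is said to be admissible in $L$ if $L$ has the disjunction property: $A\vee B\in L$ implies $A\in L$ or $B\in L$. \textbf{Corollary.} Let $L$ be a $T$-free or a $T$-full logic over $\mathcal{L}$. If for some $n\ge0$ Visser's rule $V_n$ is not admissible in $L$, then there is no constructive sequent calculus for $L$. -/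

import Mathlib

namespace IML

/-! ### Formulas -/

/-- Modal formulas over `{∧, ∨, →, ⊤, ⊥, □, ◇}`, with countably many atoms. -/
inductive Formula : Type
  | atom : ℕ → Formula
  | top : Formula
  | bot : Formula
  | and : Formula → Formula → Formula
  | or : Formula → Formula → Formula
  | imp : Formula → Formula → Formula
  | box : Formula → Formula
  | dia : Formula → Formula

namespace Formula

/-- Simultaneous substitution of formulas for atoms. -/
def subst (σ : ℕ → Formula) : Formula → Formula
  | atom p => σ p
  | top => top
  | bot => bot
  | and A B => and (subst σ A) (subst σ B)
  | or A B => or (subst σ A) (subst σ B)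
  | imp A B => imp (subst σ A) (subst σ B)
  | box A => box (subst σ A)
  | dia A => dia (subst σ A)

/-- `⋀ [A₁, …, Aₙ] = A₁ ∧ (A₂ ∧ (… ∧ Aₙ))`, with `⋀ [] = ⊤`. -/
def conj : List Formula → Formula
  | [] => top
  | [A] => A
  | A :: B :: l => and A (conj (B :: l))

/-- `⋁ [A₁, …, Aₙ] = A₁ ∨ (A₂ ∨ (… ∨ Aₙ))`, with `⋁ [] = ⊥`. -/
def disj : List Formula → Formula
  | [] => bot
  | [A] => A
  | A :: B :: l => or A (disj (B :: l))

end Formula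

open Formula

/-! ### Logics -/

/-- A logic: a set of formulas closed under substitution, modus ponens and necessitation. -/
structure IsLogic (L : Set Formula) : Prop where
  subst_mem : ∀ (σ : ℕ → Formula) (A : Formula), A ∈ L → A.subst σ ∈ L
  mp : ∀ A B : Formula, A ∈ L → imp A B ∈ L → B ∈ L
  nec : ∀ A : Formula, A ∈ L → box A ∈ L

/-- The smallest logic containing a set of formulas. -/
def leastLogic (X : Set Formula) : Set Formula :=
  {A | ∀ L : Set Formula, IsLogic L → X ⊆ L → A ∈ L}

/-- A Hilbert-style axiomatization of intuitionistic propositional logic. -/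
inductive IPCAxiom : Formula → Prop
  | k : IPCAxiom (imp (atom 0) (imp (atom 1) (atom 0)))
  | s : IPCAxiom (imp (imp (atom 0) (imp (atom 1) (atom 2)))
      (imp (imp (atom 0) (atom 1)) (imp (atom 0) (atom 2))))
  | and_left : IPCAxiom (imp (and (atom 0) (atom 1)) (atom 0))
  | and_right : IPCAxiom (imp (and (atom 0) (atom 1)) (atom 1))
  | and_intro : IPCAxiom (imp (atom 0) (imp (atom 1) (and (atom 0) (atom 1))))
  | or_left : IPCAxiom (imp (atom 0) (or (atom 0) (atom 1)))
  | or_right : IPCAxiom (imp (atom 1) (or (atom 0) (atom 1)))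
  | or_elim : IPCAxiom (imp (imp (atom 0) (atom 2))
      (imp (imp (atom 1) (atom 2)) (imp (or (atom 0) (atom 1)) (atom 2))))
  | bot_elim : IPCAxiom (imp bot (atom 0))
  | top_intro : IPCAxiom top

/-- `□(p → q) → (□p → □q)`. -/
def axKa : Formula :=
  imp (box (imp (atom 0) (atom 1))) (imp (box (atom 0)) (box (atom 1)))

/-- `□(p → q) → (◇p → ◇q)`. -/
def axKb : Formula :=
  imp (box (imp (atom 0) (atom 1))) (imp (dia (atom 0)) (dia (atom 1)))

/-- `□p → p`. -/
def axTa : Formula := imp (box (atom 0)) (atom 0)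

/-- `p → ◇p`. -/
def axTb : Formula := imp (atom 0) (dia (atom 0))

/-- The logic `CK = IPC + {K_a, K_b}`. -/
def CK : Set Formula := leastLogic ({A | IPCAxiom A} ∪ {axKa, axKb})

/-! ### Constructive modal Kripke frames -/

/-- A constructive modal Kripke frame `(W, ≤, R, F)`, with `F` the set of fallible worlds. -/
structure Frame where
  W : Type
  nonempty : Nonempty W
  le : W → W → Prop
  le_refl : ∀ w, le w w
  le_trans : ∀ u v w, le u v → le v w → le u w
  R : W → W → Prop
  F : Set W
  F_le : ∀ v w, v ∈ F → le v w → w ∈ F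
  F_R : ∀ v w, R v w → v ∈ F → w ∈ F
  F_serial : ∀ v, v ∈ F → ∃ w, w ∈ F ∧ R v w

/-- A valuation on a frame: monotone, and making every atom true at the fallible worlds. -/
structure Frame.IsValuation (𝓕 : Frame) (V : 𝓕.W → Set ℕ) : Prop where
  mono : ∀ v w, 𝓕.le v w → V v ⊆ V w
  fallible : ∀ w, w ∈ 𝓕.F → ∀ p, p ∈ V w

/-- Truth of a formula at a world. -/
def Frame.Forces (𝓕 : Frame) (V : 𝓕.W → Set ℕ) : 𝓕.W → Formula → Prop
  | w, .atom p => p ∈ V w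
  | _, .top => True
  | w, .bot => w ∈ 𝓕.F
  | w, .and A B => 𝓕.Forces V w A ∧ 𝓕.Forces V w B
  | w, .or A B => 𝓕.Forces V w A ∨ 𝓕.Forces V w B
  | w, .imp A B => ∀ v, 𝓕.le w v → 𝓕.Forces V v A → 𝓕.Forces V v B
  | w, .box A => ∀ u, 𝓕.le w u → ∀ v, 𝓕.R u v → 𝓕.Forces V v A
  | w, .dia A => ∀ u, 𝓕.le w u → ∃ v, 𝓕.R u v ∧ 𝓕.Forces V v A

/-- A formula is valid in a frame if it is true at all worlds of all models on the frame. -/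
def Frame.Valid (𝓕 : Frame) (A : Formula) : Prop :=
  ∀ V : 𝓕.W → Set ℕ, 𝓕.IsValuation V → ∀ w, 𝓕.Forces V w A

/-- A logic is valid in a frame if all its members are. -/
def Frame.ValidLogic (𝓕 : Frame) (L : Set Formula) : Prop := ∀ A ∈ L, 𝓕.Valid A

/-- The irreflexive node frame `({w}, =, ∅, ∅)`. -/
def irreflexiveNode : Frame where
  W := Unit
  nonempty := ⟨()⟩
  le := fun v w => v = w
  le_refl := fun _ => rfl
  le_trans := fun _ _ _ h₁ h₂ => h₁.trans h₂
  R := fun _ _ => False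
  F := ∅
  F_le := fun _ _ h _ => h.elim
  F_R := fun _ _ _ h => h.elim
  F_serial := fun _ h => h.elim

/-- The reflexive node frame `({w}, =, {(w, w)}, ∅)`. -/
def reflexiveNode : Frame where
  W := Unit
  nonempty := ⟨()⟩
  le := fun v w => v = w
  le_refl := fun _ => rfl
  le_trans := fun _ _ _ h₁ h₂ => h₁.trans h₂
  R := fun _ _ => True
  F := ∅
  F_le := fun _ _ h _ => h.elim
  F_R := fun _ _ _ h => h.elim
  F_serial := fun _ h => h.elim

/-- `T`-free: extends `CK` and is valid in the irreflexive node frame. -/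
structure TFree (L : Set Formula) : Prop where
  ck : CK ⊆ L
  valid : irreflexiveNode.ValidLogic L

/-- `T`-full: extends `CK`, contains `T_a` and `T_b`, and is valid in the reflexive node frame. -/
structure TFull (L : Set Formula) : Prop where
  ck : CK ⊆ L
  ta : axTa ∈ L
  tb : axTb ∈ L
  valid : reflexiveNode.ValidLogic L

/-! ### Sequents, rules and calculi -/

/-- A single-conclusion sequent: a finite multiset of formulas as antecedent, at most one formula
as succedent. -/
structure Sequent where
  ant : Multiset Formula
  suc : Option Formula

/-- The formula interpretation `⋀ Σ → ⋁ Λ` of the sequent `Σ ⇒ Λ` belongs to `L`, in whatever order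
the antecedent is enumerated. -/
def Sequent.InterpMem (S : Sequent) (L : Set Formula) : Prop :=
  ∀ l : List Formula, (l : Multiset Formula) = S.ant → imp (conj l) (disj S.suc.toList) ∈ L

/-- The succedent of a single-conclusion meta-sequent: a multiset variable (which may be
instantiated by at most one formula) or at most one formula. -/
inductive MetaSuc : Type
  | var : ℕ → MetaSuc
  | formula : Option Formula → MetaSuc

/-- A single-conclusion meta-sequent `{□Γᵢ}, {Πⱼ}, Ā ⇒ Δ` or `{□Γᵢ}, {Πⱼ}, Ā ⇒ B̄`; the multiset
variables `Γᵢ`, `Πⱼ` are given by their numbers. -/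
structure MetaSequent where
  boxed : Multiset ℕ
  ctx : Multiset ℕ
  formulas : Multiset Formula
  suc : MetaSuc

/-- An instantiation: formulas for the atoms, finite multisets of formulas for the multiset
variables in antecedents, at most one formula for those in succedents. -/
structure Inst where
  atoms : ℕ → Formula
  left : ℕ → Multiset Formula
  right : ℕ → Option Formula

/-- The instance of the succedent of a meta-sequent. -/
def MetaSuc.inst (ι : Inst) : MetaSuc → Option Formula
  | var Δ => ι.right Δ
  | formula B => B.map (Formula.subst ι.atoms)

/-- The instance of a meta-sequent. -/
def MetaSequent.inst (ι : Inst) (M : MetaSequent) : Sequent where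
  ant := (M.boxed.map fun Γ => (ι.left Γ).map box).sum + (M.ctx.map ι.left).sum
    + M.formulas.map (Formula.subst ι.atoms)
  suc := M.suc.inst ι

/-- A rule; an axiom is a rule without premises. -/
structure Rule where
  premises : Multiset MetaSequent
  conclusion : MetaSequent

/-- Provability of a sequent from a set of rules. -/
inductive Provable (G : Set Rule) : Sequent → Prop
  | step (R : Rule) (hR : R ∈ G) (ι : Inst)
      (h : ∀ M ∈ R.premises, Provable G (M.inst ι)) : Provable G (R.conclusion.inst ι)

/-- `G` is a sequent calculus of the logic `L`: `Σ ⇒ Λ` is provable in `G` iff `⋀ Σ → ⋁ Λ ∈ L`. -/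
def IsCalculusOf (G : Set Rule) (L : Set Formula) : Prop :=
  ∀ S : Sequent, Provable G S ↔ S.InterpMem L

/-- Admissibility of a rule in a logic. -/
def Rule.Admissible (R : Rule) (L : Set Formula) : Prop :=
  ∀ ι : Inst, (∀ M ∈ R.premises, (M.inst ι).InterpMem L) → (R.conclusion.inst ι).InterpMem L

/-! ### Constructive formulas and rules -/

/-- Basic formulas. -/
inductive Basic : Formula → Prop
  | atom (p : ℕ) : Basic (atom p)
  | top : Basic top
  | bot : Basic bot
  | and {A B : Formula} : Basic A → Basic B → Basic (and A B)
  | or {A B : Formula} : Basic A → Basic B → Basic (or A B)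
  | dia {A : Formula} : Basic A → Basic (dia A)

/-- Almost positive formulas. -/
inductive AlmostPositive : Formula → Prop
  | basic {A : Formula} : Basic A → AlmostPositive A
  | and {A B : Formula} : AlmostPositive A → AlmostPositive B → AlmostPositive (and A B)
  | or {A B : Formula} : AlmostPositive A → AlmostPositive B → AlmostPositive (or A B)
  | box {A : Formula} : AlmostPositive A → AlmostPositive (box A)
  | dia {A : Formula} : AlmostPositive A → AlmostPositive (dia A)
  | imp {A B : Formula} : Basic A → AlmostPositive B → AlmostPositive (imp A B)

/-- Constructive formulas. -/
inductive Constructive : Formula → Prop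
  | basic {A : Formula} : Basic A → Constructive A
  | and {A B : Formula} : Constructive A → Constructive B → Constructive (and A B)
  | box {A : Formula} : Constructive A → Constructive (box A)
  | imp {A B : Formula} : AlmostPositive A → Constructive B → Constructive (imp A B)

/-- The meta-sequent `Γ, Ā ⇒ B̄`. -/
def ctxFormula (Γ : ℕ) (A : Multiset Formula) (B : Option Formula) : MetaSequent :=
  ⟨0, {Γ}, A, .formula B⟩

/-- The meta-sequent `Γ, Ā ⇒ Δ`. -/
def ctxVar (Γ : ℕ) (A : Multiset Formula) (Δ : ℕ) : MetaSequent :=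
  ⟨0, {Γ}, A, .var Δ⟩

/-- Left constructive rules: from `{Γ, B̄ᵢ ⇒ P̄ᵢ}` (`i ∈ I`) and `{Γ, C̄ⱼ ⇒ Δ}` (`j ∈ J`) infer
`Γ, P̄ ⇒ Δ`. The families are the multisets `I` of pairs `(B̄ᵢ, P̄ᵢ)` and `J` of the `C̄ⱼ`. -/
def Rule.LeftConstructive (R : Rule) : Prop :=
  ∃ (Γ Δ : ℕ) (I : Multiset (Multiset Formula × Option Formula))
    (J : Multiset (Multiset Formula)) (P : Multiset Formula),
    (∀ i ∈ I, (∀ A ∈ i.1, Basic A) ∧ (∀ A ∈ i.2, AlmostPositive A)) ∧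
    (∀ C ∈ J, ∀ A ∈ C, Constructive A) ∧
    (1 < Multiset.card J → ∀ C ∈ J, ∀ A ∈ C, Basic A) ∧
    (∀ A ∈ P, AlmostPositive A) ∧
    R.premises = (I.map fun i => ctxFormula Γ i.1 i.2) + (J.map fun C => ctxVar Γ C Δ) ∧
    R.conclusion = ctxVar Γ P Δ

/-- Right constructive rules: from `{Γ, B̄ᵢ ⇒ P̄ᵢ}` (`i ∈ I`) infer `Γ, P̄ ⇒ C̄`. -/
def Rule.RightConstructive (R : Rule) : Prop :=
  ∃ (Γ : ℕ) (I : Multiset (Multiset Formula × Option Formula))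
    (P : Multiset Formula) (C : Option Formula),
    (∀ i ∈ I, (∀ A ∈ i.1, Basic A) ∧ (∀ A ∈ i.2, AlmostPositive A)) ∧
    (∀ A ∈ P, AlmostPositive A) ∧
    (∀ A ∈ C, Constructive A) ∧
    R.premises = (I.map fun i => ctxFormula Γ i.1 i.2) ∧
    R.conclusion = ctxFormula Γ P C

/-- The rule `(K_□)`: from `Γ ⇒ p` infer `□Γ ⇒ □p`. -/
def Rule.IsKBox (R : Rule) : Prop :=
  ∃ Γ p : ℕ, R.premises = {ctxFormula Γ 0 (some (atom p))} ∧
    R.conclusion = ⟨{Γ}, 0, 0, .formula (some (box (atom p)))⟩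

/-- The rule `(K_◇)`: from `Γ, p ⇒ q` infer `□Γ, ◇p ⇒ ◇q`. -/
def Rule.IsKDia (R : Rule) : Prop :=
  ∃ Γ p q : ℕ, p ≠ q ∧ R.premises = {ctxFormula Γ {atom p} (some (atom q))} ∧
    R.conclusion = ⟨{Γ}, 0, {dia (atom p)}, .formula (some (dia (atom q)))⟩

/-- A constructive sequent calculus: a finite set of rules, each of which is left or right
constructive, or `(K_□)`, or `(K_◇)`. -/
structure IsConstructiveCalculus (G : Set Rule) : Prop where
  finite : G.Finite
  rules : ∀ R ∈ G, R.LeftConstructive ∨ R.RightConstructive ∨ R.IsKBox ∨ R.IsKDia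

/-! ### Visser's rules -/

/-- The atom `pⱼ` in Visser's rules, `j ≥ 1`. The atoms `pⱼ`, `qᵢ` and `r = atom 0` are pairwise
distinct. -/
def visserP (j : ℕ) : Formula := atom (2 * j)

/-- The atom `qᵢ` in Visser's rules, `i ≥ 1`. -/
def visserQ (i : ℕ) : Formula := atom (2 * i + 1)

/-- `⋀_{i=1}^{n} (pᵢ → qᵢ)`. -/
def visserAnt (n : ℕ) : Formula :=
  conj ((List.range n).map fun i => imp (visserP (i + 1)) (visserQ (i + 1)))

/-- The rule `V_n`: from `⇒ (⋀_{i=1}^{n} (pᵢ → qᵢ) → p_{n+1} ∨ p_{n+2}) ∨ r` infer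
`⇒ ⋁_{j=1}^{n+2} (⋀_{i=1}^{n} (pᵢ → qᵢ) → pⱼ) ∨ r`. -/
def visserRule (n : ℕ) : Rule where
  premises := {⟨0, 0, 0, .formula (some
    (or (imp (visserAnt n) (or (visserP (n + 1)) (visserP (n + 2)))) (atom 0)))⟩}
  conclusion := ⟨0, 0, 0, .formula (some
    (or (disj ((List.range (n + 2)).map fun j => imp (visserAnt n) (visserP (j + 1)))) (atom 0)))⟩

/-- The disjunction property. -/
def DisjunctionProperty (L : Set Formula) : Prop :=
  ∀ A B : Formula, or A B ∈ L → A ∈ L ∨ B ∈ L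

/-- `L` admits `V_n`; admitting `V_0` means having the disjunction property. -/
def AdmitsVisser (L : Set Formula) : ℕ → Prop
  | 0 => DisjunctionProperty L
  | n + 1 => (visserRule (n + 1)).Admissible L

end IML

/-! Fix a hypothesis `H`. `Slash L t H` is an Aczel slash that reads ∧, ∨ and ◇ as in the node
(reflexive iff `t`), and asks in addition that implications and boxes follow from `H`. Slashed
formulas then follow from `H`. The crux is that every sequent provable in a constructive calculus
for `L` preserves the slash (`slashed_of_provable`).

A rule of the calculus is admissible in `L`. Instantiated with the atoms left alone, it therefore
says something true in the node (`nodeTruth_right`, `nodeTruth_left`). Call an atom true when its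
substitute is slashed. Then basic formulas are slashed iff true, slashed almost positive formulas
are true, and true constructive formulas are slashed once they follow from `H`. These facts carry
the rule from node truth over to the slash.

Hence implications in `L` preserve slashes (`slash_mp`). With `H = ⊤` this gives the disjunction
property. With `H = ⋀ (Pᵢ → Qᵢ)`, either `H` entails some `Pᵢ`, or no `Pᵢ` is slashed; in the latter
case `H` is slashed vacuously, and so is a disjunct of any disjunction it entails. Thus all of
Visser's rules are admissible. -/

namespace IML

open Formula

/-! ### Truth in one-node models -/

namespace Formula

theorem subst_atom (A : Formula) : A.subst atom = A := by
  induction A <;> simp_all [subst]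

/-- Truth in the one-node Kripke model with valuation `V`, the node being reflexive iff `t`. -/
def NodeTruth (t : Prop) (V : Set ℕ) : Formula → Prop
  | atom p => p ∈ V
  | top => True
  | bot => False
  | and A B => NodeTruth t V A ∧ NodeTruth t V B
  | or A B => NodeTruth t V A ∨ NodeTruth t V B
  | imp A B => NodeTruth t V A → NodeTruth t V B
  | box A => t → NodeTruth t V A
  | dia A => t ∧ NodeTruth t V A

theorem nodeTruth_conj {t : Prop} {V : Set ℕ} (l : List Formula) :
    NodeTruth t V (conj l) ↔ ∀ A ∈ l, NodeTruth t V A := by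
  induction l with
  | nil => simp [conj, NodeTruth]
  | cons A l ih => cases l <;> simp_all [conj, NodeTruth]

theorem nodeTruth_disj {t : Prop} {V : Set ℕ} (l : List Formula) :
    NodeTruth t V (disj l) ↔ ∃ A ∈ l, NodeTruth t V A := by
  induction l with
  | nil => simp [disj, NodeTruth]
  | cons A l ih => cases l <;> simp_all [disj, NodeTruth]

end Formula

theorem forces_irreflexiveNode (V : Unit → Set ℕ) (w : Unit) (A : Formula) :
    irreflexiveNode.Forces V w A ↔ A.NodeTruth False (V ()) := by
  induction A with
  | bot => exact Set.mem_empty_iff_false _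
  | _ => simp_all [Frame.Forces, NodeTruth, irreflexiveNode]

theorem forces_reflexiveNode (V : Unit → Set ℕ) (w : Unit) (A : Formula) :
    reflexiveNode.Forces V w A ↔ A.NodeTruth True (V ()) := by
  induction A with
  | bot => exact Set.mem_empty_iff_false _
  | _ => simp_all [Frame.Forces, NodeTruth, reflexiveNode]

/-! ### Logics sound in a node, and consequence from a hypothesis -/

/-- Logics over `CK` valid in the irreflexive node, or containing the `T`-axioms and valid in the
reflexive node, according to whether `t` holds. -/
structure NodeLogic (L : Set Formula) (t : Prop) : Prop where
  logic : IsLogic L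
  ck : CK ⊆ L
  ta : t → axTa ∈ L
  tb : t → axTb ∈ L
  valid : ∀ A ∈ L, ∀ V : Set ℕ, A.NodeTruth t V

theorem TFree.nodeLogic {L : Set Formula} (hL : IsLogic L) (h : TFree L) : NodeLogic L False where
  logic := hL
  ck := h.ck
  ta := False.elim
  tb := False.elim
  valid A hA V := (forces_irreflexiveNode (fun _ => V) () A).1 <|
    h.valid A hA (fun _ => V) ⟨fun _ _ _ => subset_rfl, fun _ h => h.elim⟩ ()

theorem TFull.nodeLogic {L : Set Formula} (hL : IsLogic L) (h : TFull L) : NodeLogic L True where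
  logic := hL
  ck := h.ck
  ta _ := h.ta
  tb _ := h.tb
  valid A hA V := (forces_reflexiveNode (fun _ => V) () A).1 <|
    h.valid A hA (fun _ => V) ⟨fun _ _ _ => subset_rfl, fun _ h => h.elim⟩ ()

/-- The formula `A` follows in `L` from the hypothesis `H`. -/
def Entails (L : Set Formula) (H A : Formula) : Prop := imp H A ∈ L

/-- The substitution of `A`, `B`, `C` for the first three atoms. -/
def threeAtoms (A B C : Formula) : ℕ → Formula
  | 0 => A
  | 1 => B
  | _ => C

namespace NodeLogic

variable {L : Set Formula} {t : Prop} (N : NodeLogic L t)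
include N

theorem ipc_mem {X : Formula} (h : IPCAxiom X) (σ : ℕ → Formula) : X.subst σ ∈ L :=
  N.logic.subst_mem _ _ (N.ck fun _ _ hX => hX (Or.inl h))

theorem of_mem {H A : Formula} (h : A ∈ L) : Entails L H A :=
  N.logic.mp _ _ h (N.ipc_mem .k (threeAtoms A H H))

theorem mp {H A B : Formula} (h : Entails L H A) (h' : Entails L H (imp A B)) : Entails L H B :=
  N.logic.mp _ _ h (N.logic.mp _ _ h' (N.ipc_mem .s (threeAtoms H A B)))

theorem mp_mem {H A B : Formula} (h : Entails L H A) (h' : imp A B ∈ L) : Entails L H B :=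
  N.mp h (N.of_mem h')

theorem entails_self (H : Formula) : Entails L H H :=
  N.mp (A := imp H H) (N.ipc_mem .k (threeAtoms H H H)) (N.ipc_mem .k (threeAtoms H (imp H H) H))

theorem top_mem : top ∈ L := N.ipc_mem .top_intro atom

theorem mem_iff_entails_top {A : Formula} : A ∈ L ↔ Entails L top A :=
  ⟨N.of_mem, N.logic.mp _ _ N.top_mem⟩

theorem entails_and {H A B : Formula} :
    Entails L H (and A B) ↔ Entails L H A ∧ Entails L H B :=
  ⟨fun h => ⟨N.mp_mem h (N.ipc_mem .and_left (threeAtoms A B B)),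
    N.mp_mem h (N.ipc_mem .and_right (threeAtoms A B B))⟩,
   fun h => N.mp h.2 (N.mp_mem h.1 (N.ipc_mem .and_intro (threeAtoms A B B)))⟩

theorem entails_or_left {H A B : Formula} (h : Entails L H A) : Entails L H (or A B) :=
  N.mp_mem h (N.ipc_mem .or_left (threeAtoms A B B))

theorem entails_or_right {H A B : Formula} (h : Entails L H B) : Entails L H (or A B) :=
  N.mp_mem h (N.ipc_mem .or_right (threeAtoms A B B))

theorem entails_conj {H : Formula} (l : List Formula) :
    Entails L H (conj l) ↔ ∀ A ∈ l, Entails L H A := by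
  induction l with
  | nil => simpa [conj] using N.of_mem N.top_mem
  | cons A l ih => cases l <;> simp_all [conj, N.entails_and]

theorem entails_disj {H : Formula} {l : List Formula} {A : Formula} (hA : A ∈ l)
    (h : Entails L H A) : Entails L H (disj l) := by
  induction l with
  | nil => simp at hA
  | cons B l ih =>
    cases l with
    | nil => simp_all [disj]
    | cons C l =>
      rcases List.mem_cons.1 hA with rfl | hA
      · exact N.entails_or_left h
      · exact N.entails_or_right (ih hA)

/-- Taking `H` to be the antecedent's own conjunction gives back the interpretation. Quantifying
over `H` replaces the deduction theorem and hides the order of enumeration. -/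
theorem interpMem_iff (S : Sequent) : S.InterpMem L ↔
    ∀ H, (∀ A ∈ S.ant, Entails L H A) → Entails L H (disj S.suc.toList) := by
  constructor
  · intro h H hH
    refine N.mp_mem ((N.entails_conj S.ant.toList).2 fun A hA => hH A ?_) (h _ S.ant.coe_toList)
    simpa using hA
  · intro h l hl
    refine h _ fun A hA => (N.entails_conj l).1 (N.entails_self _) A ?_
    simpa [← hl] using hA

theorem nodeTruth_of_interpMem {S : Sequent} (h : S.InterpMem L) {V : Set ℕ}
    (hV : ∀ A ∈ S.ant, A.NodeTruth t V) : ∃ A ∈ S.suc, A.NodeTruth t V := by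
  have := N.valid _ (h _ S.ant.coe_toList) V
  simp only [NodeTruth, nodeTruth_conj, nodeTruth_disj] at this
  simpa using this (by simpa using hV)

/-- Only members of `L` can be necessitated, not consequences of `H`; so the boxes are first
gathered into one box of a conjunction by `axKa`. -/
theorem box_mono {H : Formula} {l : List Formula} {A : Formula} (h : imp (conj l) A ∈ L)
    (hl : ∀ B ∈ l, Entails L H (box B)) : Entails L H (box A) := by
  have axK (A B : Formula) : imp (box (imp A B)) (imp (box A) (box B)) ∈ L :=
    N.logic.subst_mem (threeAtoms A B B) _ (N.ck fun _ _ hX => hX (Or.inr (Or.inl rfl)))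
  have hconj : ∀ l : List Formula, (∀ B ∈ l, Entails L H (box B)) →
      Entails L H (box (conj l)) := by
    intro l
    induction l with
    | nil => exact fun _ => N.of_mem (N.logic.nec _ N.top_mem)
    | cons B l ih =>
      cases l with
      | nil => simp [conj]
      | cons C l =>
        intro hl
        simp only [List.forall_mem_cons] at hl ih
        have := N.logic.nec _ (N.ipc_mem .and_intro (threeAtoms B (conj (C :: l)) B))
        exact N.mp (ih hl.2) (N.mp_mem (N.mp_mem hl.1 (N.logic.mp _ _ this (axK _ _))) (axK _ _))
  exact N.mp_mem (hconj l hl) (N.logic.mp _ _ (N.logic.nec _ h) (axK _ _))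

end NodeLogic

/-! ### The slash compared with node truth -/

/-- The Aczel slash of a formula relative to the hypothesis `H`, with the modalities read as in the
one-node frame that is reflexive iff `t`. -/
def Slash (L : Set Formula) (t : Prop) (H : Formula) : Formula → Prop
  | .atom _ => False
  | .top => True
  | .bot => False
  | .and A B => Slash L t H A ∧ Slash L t H B
  | .or A B => Slash L t H A ∨ Slash L t H B
  | .imp A B => Entails L H (imp A B) ∧ (Slash L t H A → Slash L t H B)
  | .box A => Entails L H (box A) ∧ (t → Slash L t H A)
  | .dia A => t ∧ Slash L t H A

/-- The valuation making an atom true iff its substitute is slashed. -/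
def slashVal (L : Set Formula) (t : Prop) (H : Formula) (σ : ℕ → Formula) : Set ℕ :=
  {p | Slash L t H (σ p)}

theorem slash_conj {L : Set Formula} {t : Prop} {H : Formula} (l : List Formula) :
    Slash L t H (conj l) ↔ ∀ A ∈ l, Slash L t H A := by
  induction l with
  | nil => simp [conj, Slash]
  | cons A l ih => cases l <;> simp_all [conj, Slash]

/-- Without → and □, no clause of the slash mentions `Entails`. -/
theorem Basic.slash_subst_iff {L : Set Formula} {t : Prop} {H : Formula} {σ : ℕ → Formula}
    {A : Formula} (hA : Basic A) :
    Slash L t H (A.subst σ) ↔ A.NodeTruth t (slashVal L t H σ) := by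
  induction hA <;> simp_all [subst, Slash, NodeTruth, slashVal]

/-- Antecedents of implications are basic, so their truth can be turned back into a slash. -/
theorem AlmostPositive.nodeTruth {L : Set Formula} {t : Prop} {H : Formula} {σ : ℕ → Formula}
    {A : Formula} (hA : AlmostPositive A) (h : Slash L t H (A.subst σ)) :
    A.NodeTruth t (slashVal L t H σ) := by
  induction hA with
  | basic hA => exact hA.slash_subst_iff.1 h
  | and _ _ ihA ihB => exact ⟨ihA h.1, ihB h.2⟩
  | or _ _ ihA ihB => exact h.imp ihA ihB
  | box _ ih => exact fun ht => ih (h.2 ht)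
  | dia _ ih => exact ⟨h.1, ih h.2⟩
  | imp hA _ ih => exact fun hT => ih (h.2 (hA.slash_subst_iff.2 hT))

namespace NodeLogic

variable {L : Set Formula} {t : Prop} (N : NodeLogic L t)
include N

/-- Only ◇ needs more than IPC: a slashed diamond supplies `t`, which makes `axTb` available. -/
theorem entails_of_slash {H A : Formula} (h : Slash L t H A) : Entails L H A := by
  induction A with
  | atom p => exact h.elim
  | top => exact N.of_mem N.top_mem
  | bot => exact h.elim
  | and A B ihA ihB => exact N.entails_and.2 ⟨ihA h.1, ihB h.2⟩
  | or A B ihA ihB => exact h.elim (N.entails_or_left <| ihA ·) (N.entails_or_right <| ihB ·)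
  | imp A B _ _ => exact h.1
  | box A _ => exact h.1
  | dia A ih =>
    exact N.mp_mem (ih h.2) (N.logic.subst_mem (threeAtoms A A A) _ (N.tb h.1))

/-- Outside basic parts there is no ∨ or ◇, so consequence from `H` passes to subformulas: through □
by `axTa` when `t` holds, and through → because a slashed antecedent is itself entailed. -/
theorem slash_of_constructive {H : Formula} {σ : ℕ → Formula} {A : Formula} (hA : Constructive A)
    (hE : Entails L H (A.subst σ)) (hT : A.NodeTruth t (slashVal L t H σ)) :
    Slash L t H (A.subst σ) := by
  induction hA with
  | basic hA => exact hA.slash_subst_iff.2 hT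
  | and _ _ ihA ihB =>
    have := N.entails_and.1 hE
    exact ⟨ihA this.1 hT.1, ihB this.2 hT.2⟩
  | @box A _ ih =>
    refine ⟨hE, fun ht => ih (N.mp_mem hE ?_) (hT ht)⟩
    exact N.logic.subst_mem (threeAtoms (A.subst σ) top top) _ (N.ta ht)
  | imp hA _ ih =>
    exact ⟨hE, fun hS => ih (N.mp (N.entails_of_slash hS) hE) (hT (hA.nodeTruth hS))⟩

end NodeLogic

/-! ### Admissible constructive rules are valid in the node -/

theorem IsCalculusOf.admissible {G : Set Rule} {L : Set Formula} (hG : IsCalculusOf G L) {R : Rule}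
    (hR : R ∈ G) : R.Admissible L :=
  fun ι h => (hG _).1 (.step R hR ι fun M hM => (hG _).2 (h M hM))

theorem mem_ant_ctxFormula {ι : Inst} {Γ : ℕ} {A : Multiset Formula} {B : Option Formula}
    {X : Formula} : X ∈ ((ctxFormula Γ A B).inst ι).ant ↔
      X ∈ ι.left Γ ∨ ∃ Y ∈ A, Y.subst ι.atoms = X := by
  simp [ctxFormula, MetaSequent.inst]

theorem mem_ant_ctxVar {ι : Inst} {Γ Δ : ℕ} {A : Multiset Formula}
    {X : Formula} : X ∈ ((ctxVar Γ A Δ).inst ι).ant ↔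
      X ∈ ι.left Γ ∨ ∃ Y ∈ A, Y.subst ι.atoms = X := by
  simp [ctxVar, MetaSequent.inst]

/-- The context consisting of the interpretations of the sequents `B̄ᵢ ⇒ P̄ᵢ`. -/
noncomputable def premiseContext (I : Multiset (Multiset Formula × Option Formula)) :
    Multiset Formula :=
  I.map fun i => imp (conj i.1.toList) (disj i.2.toList)

theorem nodeTruth_premiseContext {t : Prop} {V : Set ℕ}
    {I : Multiset (Multiset Formula × Option Formula)}
    (hI : ∀ i ∈ I, (∀ A ∈ i.1, A.NodeTruth t V) → ∃ A ∈ i.2, A.NodeTruth t V) :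
    ∀ A ∈ premiseContext I, A.NodeTruth t V := by
  intro A hA
  obtain ⟨i, hi, rfl⟩ := Multiset.mem_map.1 hA
  simpa [NodeTruth, nodeTruth_conj, nodeTruth_disj] using hI i hi

namespace NodeLogic

variable {L : Set Formula} {t : Prop} (N : NodeLogic L t)
include N

theorem interpMem_premiseContext {I : Multiset (Multiset Formula × Option Formula)}
    {i : Multiset Formula × Option Formula} (hi : i ∈ I) {ι : Inst} (hι : ι.atoms = atom) {Γ : ℕ}
    (hΓ : ι.left Γ = premiseContext I) : ((ctxFormula Γ i.1 i.2).inst ι).InterpMem L := by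
  rw [N.interpMem_iff]
  intro H hH
  simp only [mem_ant_ctxFormula, hι, subst_atom, hΓ] at hH
  have h := hH _ (Or.inl (Multiset.mem_map_of_mem _ hi))
  have hsuc : ((ctxFormula Γ i.1 i.2).inst ι).suc = i.2 := by
    rcases i with ⟨B, _ | P⟩ <;> simp [ctxFormula, MetaSequent.inst, MetaSuc.inst, hι, subst_atom]
  rw [hsuc]
  refine N.mp ((N.entails_conj _).2 fun A hA => hH A (Or.inr ⟨A, ?_, rfl⟩)) h
  simpa using hA

/-- With the premises' own interpretations as context, all premises hold in `L`; admissibility then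
puts the conclusion in `L`, and `L` is valid in the node. -/
theorem nodeTruth_right {R : Rule} (hR : R.Admissible L) {Γ : ℕ}
    {I : Multiset (Multiset Formula × Option Formula)} {P : Multiset Formula} {C : Option Formula}
    (hprem : R.premises = I.map fun i => ctxFormula Γ i.1 i.2)
    (hconc : R.conclusion = ctxFormula Γ P C) {V : Set ℕ}
    (hI : ∀ i ∈ I, (∀ A ∈ i.1, A.NodeTruth t V) → ∃ A ∈ i.2, A.NodeTruth t V)
    (hP : ∀ A ∈ P, A.NodeTruth t V) : ∃ A ∈ C, A.NodeTruth t V := by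
  let ι : Inst := ⟨atom, fun _ => premiseContext I, fun _ => none⟩
  have h := hR ι (by
    rw [hprem]
    intro M hM
    obtain ⟨i, hi, rfl⟩ := Multiset.mem_map.1 hM
    exact N.interpMem_premiseContext hi rfl rfl)
  rw [hconc] at h
  have := N.nodeTruth_of_interpMem h (V := V) (by
    intro A hA
    rcases mem_ant_ctxFormula.1 hA with hA | ⟨B, hB, rfl⟩
    · exact nodeTruth_premiseContext hI A hA
    · exact (subst_atom B).symm ▸ hP B hB)
  simpa [ctxFormula, MetaSequent.inst, MetaSuc.inst, ι, subst_atom] using this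

theorem nodeTruth_left {R : Rule} (hR : R.Admissible L) {Γ Δ : ℕ}
    {I : Multiset (Multiset Formula × Option Formula)} {J : Multiset (Multiset Formula)}
    {P : Multiset Formula}
    (hprem : R.premises = (I.map fun i => ctxFormula Γ i.1 i.2) + J.map fun C => ctxVar Γ C Δ)
    (hconc : R.conclusion = ctxVar Γ P Δ) {V : Set ℕ}
    (hI : ∀ i ∈ I, (∀ A ∈ i.1, A.NodeTruth t V) → ∃ A ∈ i.2, A.NodeTruth t V)
    (hP : ∀ A ∈ P, A.NodeTruth t V) : ∃ C ∈ J, ∀ A ∈ C, A.NodeTruth t V := by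
  -- Choosing the disjunction of all `⋀ C̄ⱼ` for `Δ` makes every premise with succedent `Δ` hold in
  -- `L`.
  let ι : Inst := ⟨atom, fun _ => premiseContext I,
    fun _ => some (disj (J.map fun C => conj C.toList).toList)⟩
  have h := hR ι (by
    rw [hprem]
    intro M hM
    rcases Multiset.mem_add.1 hM with hM | hM
    · obtain ⟨i, hi, rfl⟩ := Multiset.mem_map.1 hM
      exact N.interpMem_premiseContext hi rfl rfl
    · obtain ⟨C, hC, rfl⟩ := Multiset.mem_map.1 hM
      rw [N.interpMem_iff]
      intro H hH
      change Entails L H (disj (J.map fun C => conj C.toList).toList)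
      refine N.entails_disj (A := conj C.toList) ?_ ((N.entails_conj _).2 fun A hA => ?_)
      · exact Multiset.mem_toList.2 (Multiset.mem_map_of_mem _ hC)
      · exact hH A (mem_ant_ctxVar.2 (Or.inr ⟨A, by simpa using hA, subst_atom A⟩)))
  rw [hconc] at h
  have := N.nodeTruth_of_interpMem h (V := V) (by
    intro A hA
    rcases mem_ant_ctxVar.1 hA with hA | ⟨B, hB, rfl⟩
    · exact nodeTruth_premiseContext hI A hA
    · exact (subst_atom B).symm ▸ hP B hB)
  simpa [ctxVar, MetaSequent.inst, MetaSuc.inst, ι, nodeTruth_disj, nodeTruth_conj] using this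

end NodeLogic

/-! ### Soundness of constructive calculi for the slash -/

/-- Validity of a sequent with respect to the slash. -/
def Sequent.Slashed (S : Sequent) (L : Set Formula) (t : Prop) (H : Formula) : Prop :=
  (∀ A ∈ S.ant, Slash L t H A) → ∃ A ∈ S.suc, Slash L t H A

theorem nodeTruth_of_slashed_premise {L : Set Formula} {t : Prop} {H : Formula} {ι : Inst} {Γ : ℕ}
    {i : Multiset Formula × Option Formula} (hB : ∀ A ∈ i.1, Basic A)
    (hP : ∀ A ∈ i.2, AlmostPositive A) (hΓ : ∀ A ∈ ι.left Γ, Slash L t H A)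
    (h : ((ctxFormula Γ i.1 i.2).inst ι).Slashed L t H)
    (hV : ∀ A ∈ i.1, A.NodeTruth t (slashVal L t H ι.atoms)) :
    ∃ A ∈ i.2, A.NodeTruth t (slashVal L t H ι.atoms) := by
  obtain ⟨A, hA, hS⟩ := h (by
    intro A hA
    rcases mem_ant_ctxFormula.1 hA with hA | ⟨B, hB', rfl⟩
    · exact hΓ A hA
    · exact (hB B hB').slash_subst_iff.2 (hV B hB'))
  obtain ⟨B, hB', rfl⟩ := Option.map_eq_some_iff.1 hA
  exact ⟨B, hB', (hP B hB').nodeTruth hS⟩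

/-- A slashed diamond forces `t`, and then slashed boxes release slashed contents. -/
theorem slashed_kDia {L : Set Formula} {t : Prop} {R : Rule} (hR : R.IsKDia)
    {H : Formula} {ι : Inst}
    (hsl : ∀ M ∈ R.premises, (M.inst ι).Slashed L t H) : (R.conclusion.inst ι).Slashed L t H := by
  obtain ⟨Γ, p, q, -, hprem, hconc⟩ := hR
  intro hS
  rw [hconc] at hS ⊢
  have hΓ : ∀ A ∈ ι.left Γ, Slash L t H (box A) := fun A hA => hS _ (by
    simp [MetaSequent.inst, hA])
  have hp : Slash L t H (dia (ι.atoms p)) := hS _ (by simp [MetaSequent.inst, subst])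
  obtain ⟨A, hA, hSA⟩ := hsl (ctxFormula Γ {atom p} (some (atom q))) (by simp [hprem]) (by
    intro A hA
    rcases mem_ant_ctxFormula.1 hA with hA | ⟨B, hB, rfl⟩
    · exact (hΓ A hA).2 hp.1
    · obtain rfl := Multiset.mem_singleton.1 hB
      exact hp.2)
  cases hA
  exact ⟨dia (ι.atoms q), rfl, hp.1, hSA⟩

namespace NodeLogic

variable {L : Set Formula} {t : Prop} (N : NodeLogic L t)
include N

theorem slashed_right {R : Rule} (hR : R.RightConstructive) (hadm : R.Admissible L) {H : Formula}
    {ι : Inst} (hmem : ∀ M ∈ R.premises, (M.inst ι).InterpMem L)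
    (hsl : ∀ M ∈ R.premises, (M.inst ι).Slashed L t H) : (R.conclusion.inst ι).Slashed L t H := by
  have hconcl := hadm ι hmem
  obtain ⟨Γ, I, P, C, hI, hP, hC, hprem, hconc⟩ := hR
  rw [N.interpMem_iff] at hconcl
  intro hS
  have hE := hconcl H fun A hA => N.entails_of_slash (hS A hA)
  rw [hconc] at hS hE ⊢
  obtain ⟨A, hA, hT⟩ := N.nodeTruth_right hadm hprem hconc (V := slashVal L t H ι.atoms)
    (fun i hi => nodeTruth_of_slashed_premise (hI i hi).1 (hI i hi).2
      (fun A hA => hS A (mem_ant_ctxFormula.2 (Or.inl hA)))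
      (hsl _ (by rw [hprem]; exact Multiset.mem_map_of_mem _ hi)))
    (fun A hA => (hP A hA).nodeTruth (hS _ (mem_ant_ctxFormula.2 (Or.inr ⟨A, hA, rfl⟩))))
  obtain rfl : C = some A := hA
  exact ⟨_, rfl, N.slash_of_constructive (hC A rfl) hE hT⟩

/-- Node truth selects a true `C̄ⱼ`; once it is slashed, its premise slashes `Δ`. Basic formulas
need only truth. Otherwise `J` is a singleton, and admissibility shows that `H` entails `C̄`; with
several `C̄ⱼ` it would yield only their disjunction. -/
theorem slashed_left {R : Rule} (hR : R.LeftConstructive) (hadm : R.Admissible L) {H : Formula}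
    {ι : Inst} (hmem : ∀ M ∈ R.premises, (M.inst ι).InterpMem L)
    (hsl : ∀ M ∈ R.premises, (M.inst ι).Slashed L t H) : (R.conclusion.inst ι).Slashed L t H := by
  obtain ⟨Γ, Δ, I, J, P, hI, hJ, hJB, hP, hprem, hconc⟩ := hR
  intro hS
  rw [hconc] at hS ⊢
  obtain ⟨C, hC, hT⟩ := N.nodeTruth_left hadm hprem hconc (V := slashVal L t H ι.atoms)
    (fun i hi => nodeTruth_of_slashed_premise (hI i hi).1 (hI i hi).2
      (fun A hA => hS A (mem_ant_ctxVar.2 (Or.inl hA)))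
      (hsl _ (by rw [hprem]; exact Multiset.mem_add.2 (Or.inl (Multiset.mem_map_of_mem _ hi)))))
    (fun A hA => (hP A hA).nodeTruth (hS _ (mem_ant_ctxVar.2 (Or.inr ⟨A, hA, rfl⟩))))
  have hCS : ∀ A ∈ C, Slash L t H (A.subst ι.atoms) := by
    by_cases hcard : 1 < Multiset.card J
    · exact fun A hA => (hJB hcard C hC A hA).slash_subst_iff.2 (hT A hA)
    have hJC : J = {C} := by
      obtain ⟨J, rfl⟩ := Multiset.exists_cons_of_mem hC
      have : Multiset.card J = 0 := by simp at hcard; simp [hcard]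
      rw [Multiset.card_eq_zero.1 this]; rfl
    -- Take the conjunction of the `C̄` for `Δ` in the same instance.
    let κ : Inst := ⟨ι.atoms, ι.left,
      fun _ => some (conj (C.map (Formula.subst ι.atoms)).toList)⟩
    have h := hadm κ (by
      rw [hprem, hJC]
      intro M hM
      rcases Multiset.mem_add.1 hM with hM | hM
      · have := hmem M (by rw [hprem]; exact Multiset.mem_add.2 (Or.inl hM))
        obtain ⟨i, -, rfl⟩ := Multiset.mem_map.1 hM
        exact this
      · obtain rfl : M = ctxVar Γ C Δ := by simpa using hM
        rw [N.interpMem_iff]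
        intro K hK
        refine (N.entails_conj _).2 fun A hA => hK A (mem_ant_ctxVar.2 (Or.inr ?_))
        simpa using hA)
    rw [N.interpMem_iff, hconc] at h
    have hE := (N.entails_conj _).1 (h H fun A hA =>
      N.entails_of_slash (hS A (mem_ant_ctxVar.2 (mem_ant_ctxVar.1 hA))))
    exact fun A hA => N.slash_of_constructive (hJ C hC A hA)
      (hE _ (Multiset.mem_toList.2 (Multiset.mem_map_of_mem _ hA))) (hT A hA)
  refine hsl (ctxVar Γ C Δ) ?_ fun A hA => ?_
  · rw [hprem]
    exact Multiset.mem_add.2 (Or.inr (Multiset.mem_map_of_mem (fun C => ctxVar Γ C Δ) hC))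
  · rcases mem_ant_ctxVar.1 hA with hA | ⟨B, hB, rfl⟩
    · exact hS A (mem_ant_ctxVar.2 (Or.inl hA))
    · exact hCS B hB

/-- Membership of the premise in `L` gives the entailment half of the slash of the box; its slash
validity gives the other half when `t` holds. -/
theorem slashed_kBox {R : Rule} (hR : R.IsKBox) {H : Formula}
    {ι : Inst} (hmem : ∀ M ∈ R.premises, (M.inst ι).InterpMem L)
    (hsl : ∀ M ∈ R.premises, (M.inst ι).Slashed L t H) : (R.conclusion.inst ι).Slashed L t H := by
  obtain ⟨Γ, p, hprem, hconc⟩ := hR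
  have hM : ctxFormula Γ 0 (some (atom p)) ∈ R.premises := by simp [hprem]
  have hΓ : ((ctxFormula Γ 0 (some (atom p))).inst ι).ant = ι.left Γ := by
    simp [ctxFormula, MetaSequent.inst]
  intro hS
  rw [hconc] at hS ⊢
  replace hS : ∀ A ∈ ι.left Γ, Slash L t H (box A) := by
    simpa [MetaSequent.inst] using hS
  refine ⟨box (ι.atoms p), rfl, ?_, fun ht => ?_⟩
  · refine N.box_mono (hmem _ hM (ι.left Γ).toList (by simp [hΓ])) fun B hB => ?_
    exact (hS B (by simpa using hB)).1
  · obtain ⟨A, hA, hSA⟩ := hsl _ hM fun A hA => (hS A (hΓ ▸ hA)).2 ht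
    cases hA
    exact hSA

theorem slashed_of_provable {G : Set Rule} (hG : IsConstructiveCalculus G)
    (hGL : IsCalculusOf G L) (H : Formula) {S : Sequent} (hS : Provable G S) :
    S.Slashed L t H := by
  induction hS with
  | step R hR ι h ih =>
    have hmem := fun M hM => (hGL _).1 (h M hM)
    rcases hG.rules R hR with hl | hr | hb | hd
    · exact N.slashed_left hl (hGL.admissible hR) hmem ih
    · exact N.slashed_right hr (hGL.admissible hR) hmem ih
    · exact N.slashed_kBox hb hmem ih
    · exact slashed_kDia hd ih

/-! ### The disjunction property and Visser's rules -/

/-- Slashes are preserved by implications in `L`, if `L` has a constructive calculus. -/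
theorem slash_mp {G : Set Rule} (hG : IsConstructiveCalculus G) (hGL : IsCalculusOf G L)
    {H A B : Formula} (hAB : imp A B ∈ L) (hA : Slash L t H A) : Slash L t H B := by
  have hmem : Sequent.InterpMem ⟨{A}, some B⟩ L := by
    intro l hl
    obtain rfl : l = [A] := Multiset.coe_eq_singleton.1 hl
    exact hAB
  obtain ⟨C, hC, hS⟩ := N.slashed_of_provable hG hGL H ((hGL _).2 hmem) (by simpa using hA)
  cases hC
  exact hS

theorem disjunctionProperty {G : Set Rule} (hG : IsConstructiveCalculus G)
    (hGL : IsCalculusOf G L) : DisjunctionProperty L := by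
  intro A B h
  simp only [N.mem_iff_entails_top] at h ⊢
  exact (N.slash_mp hG hGL h (H := top) (A := top) trivial).imp N.entails_of_slash
    N.entails_of_slash

theorem interpMem_empty {A : Formula} : Sequent.InterpMem ⟨0, some A⟩ L ↔ A ∈ L := by
  rw [N.mem_iff_entails_top]
  constructor
  · exact fun h => h [] rfl
  · intro h l hl
    obtain rfl : l = [] := (Multiset.coe_eq_zero l).1 hl
    exact h

/-- From `⋀ᵢ (Pᵢ → Qᵢ) → A ∨ B` in `L` follows one of the implications with succedent some `Pᵢ`,
`A`, or `B`. -/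
theorem exists_entails_of_entails_or {G : Set Rule} (hG : IsConstructiveCalculus G)
    (hGL : IsCalculusOf G L) {ι : Type*} (P Q : ι → Formula) (s : List ι) {A B : Formula}
    (h : Entails L (conj (s.map fun i => imp (P i) (Q i))) (or A B)) :
    (∃ i ∈ s, Entails L (conj (s.map fun i => imp (P i) (Q i))) (P i)) ∨
      Entails L (conj (s.map fun i => imp (P i) (Q i))) A ∨
      Entails L (conj (s.map fun i => imp (P i) (Q i))) B := by
  rw [or_iff_not_imp_left]
  intro hP
  push Not at hP
  refine (N.slash_mp hG hGL h ((slash_conj _).2 fun X hX => ?_)).imp N.entails_of_slash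
    N.entails_of_slash
  have hX' := (N.entails_conj _).1 (N.entails_self _) X hX
  obtain ⟨i, hi, rfl⟩ := List.mem_map.1 hX
  -- A slashed `Pᵢ` would be entailed, so the slash condition on `Pᵢ → Qᵢ` is vacuous.
  exact ⟨hX', fun hS => absurd (N.entails_of_slash hS) (hP i hi)⟩

end NodeLogic

theorem subst_conj (σ : ℕ → Formula) (l : List Formula) :
    (conj l).subst σ = conj (l.map (Formula.subst σ)) := by
  induction l with
  | nil => rfl
  | cons A l ih => cases l <;> simp_all [conj, subst]

theorem subst_disj (σ : ℕ → Formula) (l : List Formula) :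
    (disj l).subst σ = disj (l.map (Formula.subst σ)) := by
  induction l with
  | nil => rfl
  | cons A l ih => cases l <;> simp_all [disj, subst]

theorem NodeLogic.visserRule_admissible {L : Set Formula} {t : Prop} (N : NodeLogic L t)
    {G : Set Rule} (hG : IsConstructiveCalculus G) (hGL : IsCalculusOf G L) (n : ℕ) :
    (visserRule n).Admissible L := by
  intro ι h
  replace h := N.interpMem_empty.1 (h _ (Multiset.mem_singleton_self _))
  refine N.interpMem_empty.2 ?_
  rw [N.mem_iff_entails_top]
  -- The disjunction property disposes of the side disjunct `r`.
  rcases N.disjunctionProperty hG hGL _ _ h with h | h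
  swap
  · exact N.entails_or_right (N.of_mem h)
  refine N.entails_or_left ?_
  rw [subst_disj]
  suffices hj : ∃ j < n + 2,
      Entails L ((visserAnt n).subst ι.atoms) ((visserP (j + 1)).subst ι.atoms) by
    obtain ⟨j, hj, hE⟩ := hj
    refine N.entails_disj (A := imp ((visserAnt n).subst ι.atoms)
      ((visserP (j + 1)).subst ι.atoms)) ?_ (N.of_mem hE)
    rw [List.map_map]
    exact List.mem_map.2 ⟨j, List.mem_range.2 hj, rfl⟩
  have hH : (visserAnt n).subst ι.atoms = conj ((List.range n).map fun i =>
      imp ((visserP (i + 1)).subst ι.atoms) ((visserQ (i + 1)).subst ι.atoms)) := by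
    rw [visserAnt, subst_conj, List.map_map]
    rfl
  change Entails L ((visserAnt n).subst ι.atoms) (or ((visserP (n + 1)).subst ι.atoms)
    ((visserP (n + 2)).subst ι.atoms)) at h
  rw [hH] at h ⊢
  -- The index `j` stands for `p_{j+1}`, so the last two cases take `n` and `n + 1`.
  rcases N.exists_entails_of_entails_or hG hGL _ _ _ h with ⟨i, hi, h⟩ | h | h
  · exact ⟨i, by have := List.mem_range.1 hi; lia, h⟩
  · exact ⟨n, by lia, h⟩
  · exact ⟨n + 1, by lia, h⟩

theorem NodeLogic.admitsVisser {L : Set Formula} {t : Prop} (N : NodeLogic L t)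
    {G : Set Rule} (hG : IsConstructiveCalculus G) (hGL : IsCalculusOf G L) :
    ∀ n, AdmitsVisser L n
  | 0 => N.disjunctionProperty hG hGL
  | n + 1 => N.visserRule_admissible hG hGL (n + 1)

end IML

theorem mainTheorem4 (L : Set IML.Formula) (hL : IML.IsLogic L)
    (hT : IML.TFree L ∨ IML.TFull L)
    (hV : ∃ n : ℕ, ¬ IML.AdmitsVisser L n) :
    ¬ ∃ G : Set IML.Rule, IML.IsConstructiveCalculus G ∧ IML.IsCalculusOf G L := by
  rintro ⟨G, hG, hGL⟩
  obtain ⟨n, hn⟩ := hV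
  rcases hT with h | h
  · exact hn ((h.nodeLogic hL).admitsVisser hG hGL n)
  · exact hn ((h.nodeLogic hL).admitsVisser hG hGL n)
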